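/- **Theorem (Triangle-like Relative Entropy Comparison).** A density is a complex, positive semidefinite matrix of trace one; $\le$ between Hermitian matrices is the Loewner order. For densities $\rho,\sigma$ of the same size let $D(\rho\|\sigma)=\operatorname{tr}(\rho(\ln\rho-\ln\sigma))$ if $\operatorname{supp}(\rho)\subseteq\operatorname{supp}(\sigma)$ and $D(\rho\|\sigma)=+\infty$ otherwise (with the convention $0\ln 0=0$). Let $\rho,\sigma,\omega$ be densities of the same size such that $$(1-\zeta)\,\sigma\;\le\;\omega\;\le\;(1+\zeta(c-1))\,\sigma$$ for constants $\zeta\in(0,1)$ and $c\ge 1$. Let $\eta:=(\omega-(1-\zeta)\sigma)/\zeta$, so that $\zeta\eta+(1-\zeta)\sigma=\omega$. Then $\eta$ is a density, $$(1-\zeta)^2 D(\rho\|\sigma)\;\le\;\bigl(1+\zeta(c+1)+2\zeta^2(c-1)\bigr)D(\rho\|\omega)+\zeta(2+\zeta)\,c\,D(\rho\|\eta),$$ and $$(1-\zeta)^2 D(\rho\|\sigma)\;\le\;\bigl(1+\zeta(c+1)+2\zeta^2(c-1)\bigr)D(\rho\|\omega)+3\zeta(2+\zeta)\Bigl(1+\frac{(c-1)^2}{c(\ln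 c-1)+1}\Bigr)D(\eta\|\sigma),$$ where for $c=1$ the fraction $(c-1)^2/(c(\ln c-1)+1)$ is read as its limit $2$. -/

import Mathlib

open scoped ComplexOrder MatrixOrder

namespace QuantumInfo

variable {n : Type*} [Fintype n] [DecidableEq n]

/-- A density (matrix): positive semidefinite with trace one. -/
structure IsDensity (ρ : Matrix n n ℂ) : Prop where
  posSemidef : ρ.PosSemidef
  trace_eq_one : ρ.trace = 1

/-- The support of a Hermitian matrix, i.e. the orthogonal complement of its kernel,
which is its range. -/
def supp (A : Matrix n n ℂ) : Submodule ℂ (n → ℂ) :=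
  LinearMap.range A.mulVecLin

/-- The logarithm of a positive semidefinite matrix by functional calculus. The
eigenvalue zero is sent to zero, so that this is the logarithm on the support,
extended by zero to the kernel. -/
noncomputable def matLog (A : Matrix n n ℂ) : Matrix n n ℂ :=
  cfc Real.log A

open Classical in
/-- The Umegaki relative entropy `D(ρ‖σ) = tr (ρ (ln ρ - ln σ))` if the support of `ρ` is
contained in that of `σ`, and `∞` otherwise. (For positive semidefinite arguments the trace is
real.) -/
noncomputable def relEntropy (ρ σ : Matrix n n ℂ) : EReal :=
  if supp ρ ≤ supp σ then
    (((ρ * (matLog ρ - matLog σ)).trace.re : ℝ) : EReal)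
  else ⊤

/-- The factor `(c - 1)² / (c (ln c - 1) + 1)`; at `c = 1`, where numerator and denominator
vanish, it is given its limit `2`. -/
noncomputable def compFactor (c : ℝ) : ℝ :=
  if c = 1 then 2 else (c - 1) ^ 2 / (c * (Real.log c - 1) + 1)

end QuantumInfo

/-!
The proof compares second derivatives. For densities with `supp ρ ≤ supp σ`, the relative entropy
`D(ρ‖σ)` is the Taylor remainder of `X ↦ tr (X ln X)` between `σ` and `ρ`, so that with
`σ_t = (1 - t) σ + t ρ`

  `D(ρ‖σ) = ∫₀¹ (1 - t) J(σ_t, ρ - σ) dt`,  `J(P, Δ) = ∫₀^∞ tr ((P + r)⁻¹ Δ (P + r)⁻¹ Δ) dr`.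

This is `exists_relEntropy_eq_bkmIntegral`. It is obtained without differentiating matrix functions:
for fixed `r`, the integral over `t` is the Bregman divergence of `-log det` between `ρ + r` and
`σ + r` (`lintegral_traceForm_inv`, by diagonalizing `σ + r` and `ρ - σ` simultaneously by a
congruence). In the eigenbases of `ρ` and `σ`, with eigenvalues `pᵢ` and `qⱼ`, this divergence is
a sum of scalar divergences of `-log` weighted by the squared overlaps of the eigenvectors
(`logDet_bregman_eq_sum`), and each of these integrates over `r` to
`pᵢ ln pᵢ - pᵢ ln qⱼ - pᵢ + qⱼ` (`integral_logBregman`). All integrands are nonnegative, so Tonelli's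
theorem exchanges the integrals, and singular densities need no separate treatment.

The form `J` has two properties. It is the square of a seminorm in `Δ`, whence
`J(P, A + ζ B) ≤ (1 + ζ) J(P, A) + (ζ + ζ²) J(P, B)` (`bkmForm_add_smul_le`). And
`P' ≤ K P` implies `J(P, Δ) ≤ K J(P', Δ)` (`bkmForm_le_of_le_smul`), because inversion is
operator antitone.

With `K = 1 + ζ (c - 1)` one has `ω ≤ K σ` and `η ≤ c σ`. The first inequality results from
`(1 - ζ) (ρ - σ) = (ρ - ω) - ζ (ρ - η)`, in the stronger form with coefficients `(1 + ζ) K` and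
`(ζ + ζ²) c`. The second results from `ρ - σ = (ρ - ω) + ζ (η - σ)`: the form of `η - σ` along
`σ_t ≥ (1 - t) σ` integrates to at most `J(σ, η - σ)`, and this is at most
`compFactor c * D(η‖σ)` because the segment from `σ` to `η` stays below `(1 + t (c - 1)) σ` and
`∫₀¹ (1 - t) / (1 + t (c - 1)) dt = 1 / compFactor c`.
-/

open MeasureTheory Set
open scoped ENNReal

namespace QuantumInfo

variable {n : Type*} [Fintype n] [DecidableEq n]

/-! ### The trace form of a resolvent -/

theorem re_trace_mul_nonneg {P R : Matrix n n ℂ} (hP : P.PosSemidef) (hR : R.PosSemidef) :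
    0 ≤ (P * R).trace.re := by
  obtain ⟨C, rfl⟩ := CStarAlgebra.nonneg_iff_eq_star_mul_self.mp hP.nonneg
  have h := (hR.mul_mul_conjTranspose_same C).trace_nonneg
  rw [Matrix.star_eq_conjTranspose, Matrix.mul_assoc, Matrix.trace_mul_comm]
  exact (Complex.le_def.mp h).1

/-- The quadratic form `Δ ↦ tr (X Δ X Δ)` in a Hermitian matrix `Δ`. -/
noncomputable def traceForm (X Δ : Matrix n n ℂ) : ℝ :=
  (X * Δ * X * Δ).trace.re

theorem traceForm_nonneg {X Δ : Matrix n n ℂ} (hX : X.PosSemidef) (hΔ : Δ.IsHermitian) :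
    0 ≤ traceForm X Δ := by
  have h := re_trace_mul_nonneg hX (hX.mul_mul_conjTranspose_same Δ)
  rw [hΔ.eq] at h
  simpa only [traceForm, Matrix.mul_assoc] using h

theorem traceForm_mono {X Y Δ : Matrix n n ℂ} (hX : X.PosSemidef) (hXY : X ≤ Y)
    (hΔ : Δ.IsHermitian) : traceForm X Δ ≤ traceForm Y Δ := by
  have hY : Y.PosSemidef := by simpa using hX.add hXY
  have h1 := re_trace_mul_nonneg hXY (hX.mul_mul_conjTranspose_same Δ)
  have h2 := re_trace_mul_nonneg hXY (hY.mul_mul_conjTranspose_same Δ)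
  have h3 : (X * (Δ * Y * Δ)).trace = (Y * (Δ * X * Δ)).trace := by
    rw [← Matrix.trace_mul_comm]
    simp only [Matrix.mul_assoc]
    rw [← Matrix.trace_mul_comm]
    simp only [Matrix.mul_assoc]
  rw [hΔ.eq, sub_mul, Matrix.trace_sub, Complex.sub_re] at h1 h2
  rw [h3] at h2
  simp only [traceForm, Matrix.mul_assoc] at *
  linarith

omit [DecidableEq n] in
theorem traceForm_smul_left (k : ℝ) (X Δ : Matrix n n ℂ) :
    traceForm (k • X) Δ = k ^ 2 * traceForm X Δ := by
  simp only [traceForm, Matrix.smul_mul, Matrix.mul_smul, smul_smul, Matrix.trace_smul,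
    Complex.real_smul, Complex.re_ofReal_mul, pow_two]

omit [DecidableEq n] in
theorem traceForm_smul_right (k : ℝ) (X Δ : Matrix n n ℂ) :
    traceForm X (k • Δ) = k ^ 2 * traceForm X Δ := by
  simp only [traceForm, Matrix.smul_mul, Matrix.mul_smul, smul_smul, Matrix.trace_smul,
    Complex.real_smul, Complex.re_ofReal_mul, pow_two]

/-- The triangle inequality for the seminorm `√(traceForm X)`, with the mixed term split by
`2 ζ ⟨A, B⟩ ≤ ζ ⟨A, A⟩ + ζ ⟨B, B⟩`. -/
theorem traceForm_add_smul_le {X A B : Matrix n n ℂ} (hX : X.PosSemidef) (hA : A.IsHermitian)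
    (hB : B.IsHermitian) {ζ : ℝ} (hζ : 0 ≤ ζ) :
    traceForm X (A + ζ • B) ≤ (1 + ζ) * traceForm X A + (ζ + ζ ^ 2) * traceForm X B := by
  have h := mul_nonneg hζ (traceForm_nonneg hX (hA.sub hB))
  have hc : (X * B * X * A).trace = (X * A * X * B).trace := by
    rw [Matrix.mul_assoc, Matrix.trace_mul_comm]
    simp only [Matrix.mul_assoc]
  have e1 : traceForm X (A - B) =
      traceForm X A + traceForm X B - 2 * (X * A * X * B).trace.re := by
    simp only [traceForm, mul_sub, sub_mul, Matrix.trace_sub, Complex.sub_re, hc]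
    ring
  have e2 : traceForm X (A + ζ • B) =
      traceForm X A + ζ ^ 2 * traceForm X B + 2 * ζ * (X * A * X * B).trace.re := by
    simp only [traceForm, mul_add, add_mul, Matrix.trace_add, Complex.add_re,
      Matrix.smul_mul, Matrix.mul_smul, smul_smul, Matrix.trace_smul,
      Complex.real_smul, Complex.re_ofReal_mul, hc]
    ring
  rw [e2]
  rw [e1] at h
  linarith

section

-- The operator norm makes the matrices a C⋆-algebra, where inversion is antitone.
open scoped Matrix.Norms.L2Operator

theorem inv_le_inv_of_le {A B : Matrix n n ℂ} (hA : A.PosDef) (hAB : A ≤ B) : B⁻¹ ≤ A⁻¹ := by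
  have hB : B.PosDef := by simpa using hA.add_posSemidef hAB
  have h := CStarAlgebra.inv_le_inv (a := hA.isUnit.unit) (b := hB.isUnit.unit)
    hA.posSemidef.nonneg hAB
  simpa only [Matrix.coe_units_inv, IsUnit.unit_spec] using h

end

omit [Fintype n] in
theorem posDef_add_smul_one {P : Matrix n n ℂ} (hP : P.PosSemidef) {r : ℝ} (hr : 0 < r) :
    (P + r • (1 : Matrix n n ℂ)).PosDef :=
  Matrix.PosDef.posSemidef_add hP (Matrix.PosDef.one.smul hr)

/-- If `P' ≤ K P`, then the form of the resolvent of `P` at `r` is dominated by that of `P'` at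
the rescaled parameter `K r`. -/
theorem traceForm_resolvent_le {P P' Δ : Matrix n n ℂ} (hP : P.PosSemidef) (hP' : P'.PosSemidef)
    (hΔ : Δ.IsHermitian) {K r : ℝ} (hK : 0 < K) (hr : 0 < r) (hle : P' ≤ K • P) :
    traceForm (P + r • (1 : Matrix n n ℂ))⁻¹ Δ ≤
      K ^ 2 * traceForm (P' + (K * r) • (1 : Matrix n n ℂ))⁻¹ Δ := by
  rw [← traceForm_smul_left]
  have hd := posDef_add_smul_one hP hr
  have hd' := posDef_add_smul_one hP' (mul_pos hK hr)
  refine traceForm_mono hd.inv.posSemidef ?_ hΔ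
  have h1 : K⁻¹ • (P' + (K * r) • (1 : Matrix n n ℂ)) ≤ P + r • (1 : Matrix n n ℂ) := by
    rw [Matrix.le_iff]
    have := Matrix.PosSemidef.smul (Matrix.le_iff.mp hle) (inv_nonneg.mpr hK.le)
    convert this using 1
    rw [smul_add, smul_sub, smul_smul, smul_smul, inv_mul_cancel_left₀ hK.ne',
      inv_mul_cancel₀ hK.ne', one_smul]
    abel
  have h2 := inv_le_inv_of_le (hd'.smul (inv_pos.mpr hK)) h1
  convert h2 using 1
  refine (Matrix.inv_eq_left_inv ?_).symm
  rw [Matrix.smul_mul, Matrix.mul_smul, smul_smul, mul_inv_cancel₀ hK.ne', one_smul,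
    Matrix.nonsing_inv_mul _ ((Matrix.isUnit_iff_isUnit_det _).mp hd'.isUnit)]

/-! ### Scalar integrals -/

theorem lintegral_Ioo_zero_one_ofReal_of_hasDerivAt {f g : ℝ → ℝ}
    (hg : ∀ t ∈ Icc (0 : ℝ) 1, HasDerivAt g (f t) t) (hf : ContinuousOn f (Icc 0 1))
    (hf0 : ∀ t ∈ Ioo (0 : ℝ) 1, 0 ≤ f t) :
    ∫⁻ t in Ioo (0 : ℝ) 1, ENNReal.ofReal (f t) = ENNReal.ofReal (g 1 - g 0) := by
  have hint : IntervalIntegrable f volume 0 1 :=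
    ContinuousOn.intervalIntegrable (by rwa [uIcc_of_le zero_le_one])
  have h1 := intervalIntegral.integral_eq_sub_of_hasDerivAt
    (fun t ht => hg t (by rwa [uIcc_of_le zero_le_one] at ht)) hint
  rw [intervalIntegral.integral_of_le zero_le_one, integral_Ioc_eq_integral_Ioo] at h1
  rw [← h1, ofReal_integral_eq_lintegral_ofReal]
  · exact ((intervalIntegrable_iff_integrableOn_Ioo_of_le zero_le_one).mp hint)
  · exact (ae_restrict_iff' measurableSet_Ioo).mpr (Filter.Eventually.of_forall hf0)

theorem one_add_mul_pos {κ t : ℝ} (hκ : -1 < κ) (ht : t ∈ Icc (0 : ℝ) 1) : 0 < 1 + t * κ := by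
  nlinarith [ht.1, ht.2, mul_nonneg ht.1 (by linarith : (0 : ℝ) ≤ κ + 1)]

/-- Taylor's formula with integral remainder for `-log` at `1`. -/
theorem lintegral_sub_log {κ : ℝ} (hκ : -1 < κ) :
    ∫⁻ t in Ioo (0 : ℝ) 1, ENNReal.ofReal ((1 - t) * (κ ^ 2 / (1 + t * κ) ^ 2)) =
      ENNReal.ofReal (κ - Real.log (1 + κ)) := by
  rw [lintegral_Ioo_zero_one_ofReal_of_hasDerivAt
    (g := fun t => -((1 - t) * κ / (1 + t * κ)) - Real.log (1 + t * κ))]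
  · congr 1
    simp only [sub_self, zero_mul, zero_div, neg_zero, one_mul, sub_zero, add_zero, div_one,
      Real.log_one]
    ring
  · intro t ht
    have h := one_add_mul_pos hκ ht
    have h1 : HasDerivAt (fun t : ℝ => 1 + t * κ) κ t := by
      simpa using ((hasDerivAt_id t).mul_const κ).const_add 1
    have h2 : HasDerivAt (fun t : ℝ => (1 - t) * κ) (-κ) t := by
      simpa using ((hasDerivAt_id t).const_sub 1).mul_const κ
    refine ((h2.div h1 h.ne').neg.sub (h1.log h.ne')).congr_deriv ?_
    field_simp
    ring
  · refine ContinuousOn.mul (by fun_prop) (ContinuousOn.div (by fun_prop) (by fun_prop) ?_)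
    intro t ht
    exact (pow_pos (one_add_mul_pos hκ ht) 2).ne'
  · intro t ht
    have := ht.2
    exact mul_nonneg (by linarith) (by positivity)

theorem compFactor_denom_pos {c : ℝ} (hc : 1 < c) : 0 < c * (Real.log c - 1) + 1 := by
  have hc0 : 0 < c := by linarith
  have h := Real.log_lt_sub_one_of_pos (inv_pos.mpr hc0) (by
    intro h
    rw [inv_eq_one] at h
    linarith)
  rw [Real.log_inv] at h
  have := mul_lt_mul_of_pos_left h hc0
  rw [mul_sub, mul_inv_cancel₀ hc0.ne'] at this
  linarith

theorem compFactor_pos {c : ℝ} (hc : 1 ≤ c) : 0 < compFactor c := by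
  unfold compFactor
  split_ifs with h
  · norm_num
  · have hc : 1 < c := lt_of_le_of_ne hc (Ne.symm h)
    have := compFactor_denom_pos hc
    have : 0 < c - 1 := by linarith
    positivity

/-- The integral is the reciprocal of `compFactor c`, also in the limiting case `c = 1`. -/
theorem lintegral_compFactor {c : ℝ} (hc : 1 ≤ c) :
    ∫⁻ t in Ioo (0 : ℝ) 1, ENNReal.ofReal ((1 - t) / (1 + t * (c - 1))) =
      ENNReal.ofReal (compFactor c)⁻¹ := by
  have hpos : ∀ t ∈ Icc (0 : ℝ) 1, 0 < 1 + t * (c - 1) :=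
    fun t ht => one_add_mul_pos (by linarith) ht
  have hcont : ContinuousOn (fun t : ℝ => (1 - t) / (1 + t * (c - 1))) (Icc 0 1) :=
    ContinuousOn.div (by fun_prop) (by fun_prop) fun t ht => (hpos t ht).ne'
  have hnn : ∀ t ∈ Ioo (0 : ℝ) 1, 0 ≤ (1 - t) / (1 + t * (c - 1)) := fun t ht =>
    div_nonneg (by linarith [ht.2]) (hpos t (Ioo_subset_Icc_self ht)).le
  by_cases h1 : c = 1
  · subst h1
    rw [lintegral_Ioo_zero_one_ofReal_of_hasDerivAt (g := fun t => t - t ^ 2 / 2) ?_ hcont hnn]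
    · norm_num [compFactor]
    · intro t _
      refine ((hasDerivAt_id t).sub ((hasDerivAt_pow 2 t).div_const 2)).congr_deriv ?_
      simp
  · have hc1 : c - 1 ≠ 0 := sub_ne_zero.mpr h1
    rw [lintegral_Ioo_zero_one_ofReal_of_hasDerivAt
      (g := fun t => c / (c - 1) ^ 2 * Real.log (1 + t * (c - 1)) - t / (c - 1)) ?_ hcont hnn]
    · congr 1
      simp only [compFactor, if_neg h1, inv_div]
      simp
      field_simp
      ring
    · intro t ht
      have h := hpos t ht
      have hd : HasDerivAt (fun t : ℝ => 1 + t * (c - 1)) (c - 1) t := by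
        simpa using ((hasDerivAt_id t).mul_const (c - 1)).const_add 1
      refine (((hd.log h.ne').const_mul (c / (c - 1) ^ 2)).sub
        ((hasDerivAt_id t).div_const (c - 1))).congr_deriv ?_
      obtain ⟨a, rfl⟩ : ∃ a, c = a + 1 := ⟨c - 1, by ring⟩
      simp only [add_sub_cancel_right] at h hc1 ⊢
      have h' : 1 + a * t ≠ 0 := by rw [mul_comm]; exact h.ne'
      field_simp
      ring

/-- The Bregman divergence of `-log` between `p + r` and `q + r`. -/
noncomputable def logBregman (p q r : ℝ) : ℝ :=
  Real.log (q + r) - Real.log (p + r) + (p - q) / (q + r)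

theorem logBregman_nonneg {p q r : ℝ} (hp : 0 ≤ p) (hq : 0 ≤ q) (hr : 0 < r) :
    0 ≤ logBregman p q r := by
  have hp' : 0 < p + r := by linarith
  have hq' : 0 < q + r := by linarith
  have h := Real.log_le_sub_one_of_pos (div_pos hp' hq')
  rw [Real.log_div hp'.ne' hq'.ne'] at h
  have e : (p - q) / (q + r) = (p + r) / (q + r) - 1 := by field_simp; ring
  rw [logBregman, e]
  linarith

/-- `(p + r) (log (q + r) - log (p + r))` is a primitive of `logBregman p q` in `r`. -/
theorem hasDerivAt_logBregman_primitive {p q r : ℝ} (hp : 0 ≤ p) (hq : 0 ≤ q) (hr : 0 < r) :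
    HasDerivAt (fun r => (p + r) * Real.log (q + r) - (p + r) * Real.log (p + r))
      (logBregman p q r) r := by
  have hp' : 0 < p + r := by linarith
  have hq' : 0 < q + r := by linarith
  have d1 : HasDerivAt (fun r => p + r) 1 r := (hasDerivAt_id r).const_add p
  have d2 : HasDerivAt (fun r => q + r) 1 r := (hasDerivAt_id r).const_add q
  refine ((d1.mul (d2.log hq'.ne')).sub (d1.mul (d1.log hp'.ne'))).congr_deriv ?_
  rw [logBregman]
  field_simp
  ring

theorem tendsto_logBregman_primitive (p q : ℝ) :
    Filter.Tendsto (fun r => (p + r) * Real.log (q + r) - (p + r) * Real.log (p + r))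
      Filter.atTop (nhds (q - p)) := by
  have h := (Real.tendsto_mul_log_one_add_div_atTop (q - p)).comp
    (Filter.tendsto_atTop_add_const_left Filter.atTop p Filter.tendsto_id)
  refine h.congr' ?_
  filter_upwards [Filter.eventually_gt_atTop (max (-p) (-q))] with r hr
  have hp' : 0 < p + r := by linarith [le_max_left (-p) (-q)]
  have hq' : 0 < q + r := by linarith [le_max_right (-p) (-q)]
  simp only [Function.comp, id]
  rw [← mul_sub, ← Real.log_div hq'.ne' hp'.ne']
  congr 2
  field_simp
  ring

theorem continuousWithinAt_logBregman_primitive {p q : ℝ} (hq : 0 < q) :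
    ContinuousWithinAt (fun r => (p + r) * Real.log (q + r) - (p + r) * Real.log (p + r))
      (Ici 0) 0 := by
  refine ContinuousAt.continuousWithinAt (ContinuousAt.sub ?_ ?_)
  · exact ContinuousAt.mul (by fun_prop) (ContinuousAt.log (by fun_prop) (by simpa using hq.ne'))
  · exact (Real.continuous_mul_log.comp (continuous_const.add continuous_id)).continuousAt

/-- The case `p = q = 0` is included since eigenvectors in both kernels may overlap. -/
theorem integrableOn_logBregman {p q : ℝ} (hp : 0 ≤ p) (hq : 0 ≤ q) (hpq : q = 0 → p = 0) :
    IntegrableOn (logBregman p q) (Ioi 0) := by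
  rcases hq.eq_or_lt with rfl | hq'
  · rw [hpq rfl]
    have h : logBregman 0 0 = 0 := by
      ext r
      simp [logBregman]
    rw [h]
    exact integrableOn_zero
  · exact integrableOn_Ioi_deriv_of_nonneg (continuousWithinAt_logBregman_primitive hq')
      (fun r hr => hasDerivAt_logBregman_primitive hp hq hr)
      (fun r hr => logBregman_nonneg hp hq hr) (tendsto_logBregman_primitive p q)

/-- Integration over `r` turns the Bregman divergence of `-log` into that of `x ↦ x log x`. -/
theorem integral_logBregman {p q : ℝ} (hp : 0 ≤ p) (hq : 0 ≤ q) (hpq : q = 0 → p = 0) :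
    ∫ r in Ioi (0 : ℝ), logBregman p q r = p * Real.log p - p * Real.log q - p + q := by
  rcases hq.eq_or_lt with rfl | hq'
  · rw [hpq rfl]
    simp [logBregman]
  · rw [integral_Ioi_of_hasDerivAt_of_nonneg (continuousWithinAt_logBregman_primitive hq')
      (fun r hr => hasDerivAt_logBregman_primitive hp hq hr)
      (fun r hr => logBregman_nonneg hp hq hr) (tendsto_logBregman_primitive p q)]
    simp only [add_zero]
    ring

/-! ### Taylor's formula for the logarithm of the determinant -/

/-- A positive definite matrix and a Hermitian matrix are simultaneously diagonalized by a
congruence. -/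
theorem exists_congruence_diagonal {B Δ : Matrix n n ℂ} (hB : B.PosDef) (hΔ : Δ.IsHermitian) :
    ∃ (V : Matrix n n ℂ) (κ : n → ℝ), IsUnit V ∧ B = V * star V ∧
      Δ = V * Matrix.diagonal (fun i => (κ i : ℂ)) * star V := by
  obtain ⟨C, hC, rfl⟩ := CStarAlgebra.isStrictlyPositive_iff_eq_star_mul_self.mp
    (Matrix.isStrictlyPositive_iff_posDef.mpr hB)
  have hCd : IsUnit C.det := (Matrix.isUnit_iff_isUnit_det _).mp hC
  have hN : (star C⁻¹ * Δ * C⁻¹).IsHermitian := by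
    simp only [Matrix.IsHermitian, Matrix.star_eq_conjTranspose, Matrix.conjTranspose_mul,
      Matrix.conjTranspose_conjTranspose, hΔ.eq, Matrix.mul_assoc]
  have hspec := hN.spectral_theorem
  have hcoe : (RCLike.ofReal ∘ hN.eigenvalues : n → ℂ) = fun i => (hN.eigenvalues i : ℂ) := rfl
  rw [Unitary.conjStarAlgAut_apply, hcoe] at hspec
  set U : Matrix n n ℂ := hN.eigenvectorUnitary.1
  have hUU : U * star U = 1 := Unitary.coe_mul_star_self _
  have hC1 : C⁻¹ * C = 1 := Matrix.nonsing_inv_mul _ hCd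
  have hC2 : star C * star C⁻¹ = 1 := by rw [← star_mul, hC1, star_one]
  refine ⟨star C * U, hN.eigenvalues, hC.star.mul ?_, ?_, ?_⟩
  · exact (Unitary.toUnits hN.eigenvectorUnitary).isUnit
  · rw [star_mul, star_star, Matrix.mul_assoc, ← Matrix.mul_assoc U, hUU, Matrix.one_mul]
  · calc Δ = star C * star C⁻¹ * Δ * (C⁻¹ * C) := by rw [hC1, hC2, Matrix.one_mul, Matrix.mul_one]
      _ = star C * (star C⁻¹ * Δ * C⁻¹) * C := by simp only [Matrix.mul_assoc]
      _ = star C * (U * Matrix.diagonal (fun i => (hN.eigenvalues i : ℂ)) * star U) * C :=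
        congrArg (fun M => star C * M * C) hspec
      _ = _ := by
        rw [star_mul, star_star]
        simp only [Matrix.mul_assoc]

theorem congruence_inv_mul {V : Matrix n n ℂ} (hV : IsUnit V) {a : n → ℝ} (ha : ∀ i, 0 < a i)
    (b : n → ℝ) :
    (V * Matrix.diagonal (fun i => (a i : ℂ)) * star V)⁻¹ *
        (V * Matrix.diagonal (fun i => (b i : ℂ)) * star V) =
      (star V)⁻¹ * Matrix.diagonal (fun i => ((b i / a i : ℝ) : ℂ)) * star V := by
  have h1 : V⁻¹ * V = 1 := Matrix.nonsing_inv_mul _ ((Matrix.isUnit_iff_isUnit_det _).mp hV)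
  have h2 : (Matrix.diagonal (fun i => (a i : ℂ)))⁻¹ =
      Matrix.diagonal (fun i => ((a i)⁻¹ : ℂ)) := by
    refine Matrix.inv_eq_left_inv ?_
    rw [Matrix.diagonal_mul_diagonal, ← Matrix.diagonal_one]
    congr 1
    ext i
    exact inv_mul_cancel₀ (Complex.ofReal_ne_zero.mpr (ha i).ne')
  rw [Matrix.mul_inv_rev, Matrix.mul_inv_rev, h2]
  calc _ = (star V)⁻¹ * (Matrix.diagonal (fun i => ((a i)⁻¹ : ℂ)) * ((V⁻¹ * V) *
        Matrix.diagonal (fun i => (b i : ℂ)))) * star V := by simp only [Matrix.mul_assoc]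
    _ = _ := by
      rw [h1, Matrix.one_mul, Matrix.diagonal_mul_diagonal]
      congr 3
      ext i
      push_cast
      rw [mul_comm, div_eq_mul_inv]

theorem trace_congruence {V : Matrix n n ℂ} (hV : IsUnit V) (D : Matrix n n ℂ) :
    ((star V)⁻¹ * D * star V).trace = D.trace := by
  rw [Matrix.mul_assoc, Matrix.trace_mul_comm, Matrix.mul_assoc, Matrix.mul_nonsing_inv _
    ((Matrix.isUnit_iff_isUnit_det _).mp hV.star), Matrix.mul_one]

theorem log_det_congruence {V : Matrix n n ℂ} (hV : IsUnit V) {a : n → ℝ} (ha : ∀ i, 0 < a i) :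
    Real.log (V * Matrix.diagonal (fun i => (a i : ℂ)) * star V).det.re =
      Real.log (Complex.normSq V.det) + ∑ i, Real.log (a i) := by
  have hd : V.det ≠ 0 := ((Matrix.isUnit_iff_isUnit_det _).mp hV).ne_zero
  have h : (V * Matrix.diagonal (fun i => (a i : ℂ)) * star V).det =
      ((Complex.normSq V.det * ∏ i, a i : ℝ) : ℂ) := by
    rw [Matrix.det_mul, Matrix.det_mul, Matrix.star_eq_conjTranspose, Matrix.det_conjTranspose,
      Matrix.det_diagonal, Complex.ofReal_mul, Complex.normSq_eq_conj_mul_self]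
    push_cast
    simp only [Complex.star_def]
    ring
  rw [h, Complex.ofReal_re, Real.log_mul (by simpa using hd)
    (Finset.prod_pos fun i _ => ha i).ne', Real.log_prod fun i _ => (ha i).ne']

/-- Taylor's formula with integral remainder for `-log det`, between `B` and `B + Δ`. -/
theorem lintegral_traceForm_inv {B Δ : Matrix n n ℂ} (hB : B.PosDef) (hΔ : Δ.IsHermitian)
    (hBΔ : (B + Δ).PosDef) :
    ∫⁻ t in Ioo (0 : ℝ) 1, ENNReal.ofReal ((1 - t) * traceForm (B + t • Δ)⁻¹ Δ) =
      ENNReal.ofReal (Real.log B.det.re - Real.log (B + Δ).det.re + (B⁻¹ * Δ).trace.re) := by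
  obtain ⟨V, κ, hV, hBV, hΔV⟩ := exists_congruence_diagonal hB hΔ
  have hpath : ∀ t : ℝ, B + t • Δ =
      V * Matrix.diagonal (fun i => ((1 + t * κ i : ℝ) : ℂ)) * star V := by
    intro t
    have : Matrix.diagonal (fun i => ((1 + t * κ i : ℝ) : ℂ)) =
        1 + t • Matrix.diagonal (fun i => (κ i : ℂ)) := by
      rw [← Matrix.diagonal_one, ← Matrix.diagonal_smul, Matrix.diagonal_add]
      congr 1
      ext i
      simp
    rw [this, mul_add, add_mul, mul_one, ← hBV, Matrix.mul_smul, Matrix.smul_mul, ← hΔV]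
  have h0 := hpath 0
  have h1 := hpath 1
  simp only [zero_smul, add_zero, one_smul, zero_mul, one_mul] at h0 h1
  have hκ : ∀ i, -1 < κ i := by
    rw [h1, Matrix.IsUnit.posDef_star_right_conjugate_iff hV, Matrix.posDef_diagonal_iff] at hBΔ
    intro i
    have := Complex.zero_lt_real.mp (hBΔ i)
    linarith
  have hpos : ∀ t ∈ Icc (0 : ℝ) 1, ∀ i, 0 < 1 + t * κ i := fun t ht i =>
    one_add_mul_pos (hκ i) ht
  have hleft : ∀ t ∈ Ioo (0 : ℝ) 1, (1 - t) * traceForm (B + t • Δ)⁻¹ Δ =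
      ∑ i, (1 - t) * (κ i ^ 2 / (1 + t * κ i) ^ 2) := by
    intro t ht
    have hp := hpos t (Ioo_subset_Icc_self ht)
    have hm : (B + t • Δ)⁻¹ * Δ =
        (star V)⁻¹ * Matrix.diagonal (fun i => ((κ i / (1 + t * κ i) : ℝ) : ℂ)) * star V := by
      rw [hpath, ← congruence_inv_mul hV hp, ← hΔV]
    have hVV : star V * (star V)⁻¹ = 1 :=
      Matrix.mul_nonsing_inv _ ((Matrix.isUnit_iff_isUnit_det _).mp hV.star)
    have hs : (B + t • Δ)⁻¹ * Δ * (B + t • Δ)⁻¹ * Δ =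
        (star V)⁻¹ * Matrix.diagonal (fun i => (((κ i / (1 + t * κ i)) ^ 2 : ℝ) : ℂ)) * star V := by
      rw [Matrix.mul_assoc ((B + t • Δ)⁻¹ * Δ), hm]
      calc _ = (star V)⁻¹ * (Matrix.diagonal (fun i => ((κ i / (1 + t * κ i) : ℝ) : ℂ)) *
            ((star V * (star V)⁻¹) *
              Matrix.diagonal (fun i => ((κ i / (1 + t * κ i) : ℝ) : ℂ)))) * star V := by
            simp only [Matrix.mul_assoc]
        _ = _ := by
          rw [hVV, Matrix.one_mul, Matrix.diagonal_mul_diagonal]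
          simp only [pow_two, Complex.ofReal_mul]
    rw [traceForm, hs, trace_congruence hV, Matrix.trace_diagonal, ← Complex.ofReal_sum,
      Complex.ofReal_re, Finset.mul_sum]
    simp only [div_pow]
  have hright : Real.log B.det.re - Real.log (B + Δ).det.re + (B⁻¹ * Δ).trace.re =
      ∑ i, (κ i - Real.log (1 + κ i)) := by
    have ht : (B⁻¹ * Δ).trace.re = ∑ i, κ i := by
      have h := congruence_inv_mul hV (a := fun _ => 1) (fun _ => one_pos) κ
      rw [← hΔV, ← h0] at h
      rw [h, trace_congruence hV, Matrix.trace_diagonal]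
      simp
    rw [ht, h1, log_det_congruence hV (fun i => by linarith [hκ i])]
    conv_lhs => rw [h0]
    rw [log_det_congruence hV (fun i => one_pos), Finset.sum_sub_distrib]
    simp
    ring
  rw [hright, ENNReal.ofReal_sum_of_nonneg, setLIntegral_congr_fun measurableSet_Ioo
    (fun t ht => by rw [hleft t ht, ENNReal.ofReal_sum_of_nonneg (fun i _ =>
      mul_nonneg (by linarith [ht.2]) (by positivity))]), lintegral_finsetSum]
  · exact Finset.sum_congr rfl fun i _ => lintegral_sub_log (hκ i)
  · intro i _
    fun_prop
  · intro i _
    have := Real.log_le_sub_one_of_pos (show 0 < 1 + κ i by linarith [hκ i])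
    linarith

/-! ### Spectral expansion of the relative entropy -/

/-- The function `f` of a Hermitian matrix, written out in the eigenbasis. -/
noncomputable def spectralFun {A : Matrix n n ℂ} (hA : A.IsHermitian) (f : ℝ → ℝ) :
    Matrix n n ℂ :=
  hA.eigenvectorUnitary.1 * Matrix.diagonal (fun i => (f (hA.eigenvalues i) : ℂ)) *
    star hA.eigenvectorUnitary.1

/-- The squared overlap `|⟨aᵢ, bⱼ⟩|²` of the eigenvectors of two Hermitian matrices. -/
noncomputable def overlap {A B : Matrix n n ℂ} (hA : A.IsHermitian) (hB : B.IsHermitian)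
    (i j : n) : ℝ :=
  Complex.normSq ((star hA.eigenvectorUnitary.1 * hB.eigenvectorUnitary.1) i j)

theorem matLog_eq_spectralFun {A : Matrix n n ℂ} (hA : A.IsHermitian) :
    matLog A = spectralFun hA Real.log := by
  rw [matLog, hA.cfc_eq, Matrix.IsHermitian.cfc, Unitary.conjStarAlgAut_apply]
  rfl

theorem spectralFun_id {A : Matrix n n ℂ} (hA : A.IsHermitian) :
    spectralFun hA (fun x => x) = A := by
  conv_rhs => rw [hA.spectral_theorem, Unitary.conjStarAlgAut_apply]
  rfl

theorem spectralFun_const {A : Matrix n n ℂ} (hA : A.IsHermitian) (r : ℝ) :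
    spectralFun hA (fun _ => r) = r • (1 : Matrix n n ℂ) := by
  have h : Matrix.diagonal (fun _ : n => (r : ℂ)) = r • (1 : Matrix n n ℂ) := by
    rw [← Matrix.diagonal_one, ← Matrix.diagonal_smul]
    congr 1
    ext i
    simp
  rw [spectralFun, h, Matrix.mul_smul, Matrix.smul_mul, Matrix.mul_one]
  exact congrArg _ (Unitary.coe_mul_star_self _)

theorem spectralFun_add {A : Matrix n n ℂ} (hA : A.IsHermitian) (f g : ℝ → ℝ) :
    spectralFun hA (fun x => f x + g x) = spectralFun hA f + spectralFun hA g := by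
  simp only [spectralFun, ← add_mul, ← mul_add, Matrix.diagonal_add, Complex.ofReal_add]

theorem spectralFun_mul {A : Matrix n n ℂ} (hA : A.IsHermitian) (f g : ℝ → ℝ) :
    spectralFun hA f * spectralFun hA g = spectralFun hA (fun x => f x * g x) := by
  have h : star hA.eigenvectorUnitary.1 * hA.eigenvectorUnitary.1 = 1 :=
    Unitary.coe_star_mul_self _
  simp only [spectralFun, Complex.ofReal_mul, ← Matrix.diagonal_mul_diagonal]
  simp only [Matrix.mul_assoc]
  rw [← Matrix.mul_assoc (star hA.eigenvectorUnitary.1), h, Matrix.one_mul]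

theorem spectralFun_congr {A : Matrix n n ℂ} (hA : A.IsHermitian) {f g : ℝ → ℝ}
    (h : ∀ i, f (hA.eigenvalues i) = g (hA.eigenvalues i)) :
    spectralFun hA f = spectralFun hA g := by
  simp only [spectralFun, h]

theorem add_smul_one_eq_spectralFun {A : Matrix n n ℂ} (hA : A.IsHermitian) (r : ℝ) :
    A + r • (1 : Matrix n n ℂ) = spectralFun hA (fun x => x + r) := by
  rw [spectralFun_add, spectralFun_id, spectralFun_const]

theorem inv_add_smul_one_eq_spectralFun {A : Matrix n n ℂ} (hA : A.PosSemidef) {r : ℝ}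
    (hr : 0 < r) :
    (A + r • (1 : Matrix n n ℂ))⁻¹ = spectralFun hA.isHermitian (fun x => (x + r)⁻¹) := by
  refine Matrix.inv_eq_left_inv ?_
  rw [add_smul_one_eq_spectralFun hA.isHermitian, spectralFun_mul,
    spectralFun_congr hA.isHermitian (g := fun _ => 1), spectralFun_const, one_smul]
  intro i
  have := hA.eigenvalues_nonneg i
  exact inv_mul_cancel₀ (by linarith)

theorem re_trace_spectralFun {A : Matrix n n ℂ} (hA : A.IsHermitian) (f : ℝ → ℝ) :
    (spectralFun hA f).trace.re = ∑ i, f (hA.eigenvalues i) := by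
  have h : star hA.eigenvectorUnitary.1 * hA.eigenvectorUnitary.1 = 1 :=
    Unitary.coe_star_mul_self _
  rw [spectralFun, Matrix.trace_mul_comm, ← Matrix.mul_assoc, h, Matrix.one_mul,
    Matrix.trace_diagonal, ← Complex.ofReal_sum, Complex.ofReal_re]

theorem det_spectralFun {A : Matrix n n ℂ} (hA : A.IsHermitian) (f : ℝ → ℝ) :
    (spectralFun hA f).det.re = ∏ i, f (hA.eigenvalues i) := by
  have h : star hA.eigenvectorUnitary.1 * hA.eigenvectorUnitary.1 = 1 :=
    Unitary.coe_star_mul_self _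
  rw [spectralFun, Matrix.det_mul_comm, ← Matrix.mul_assoc, h, Matrix.one_mul,
    Matrix.det_diagonal, ← Complex.ofReal_prod, Complex.ofReal_re]

theorem re_trace_spectralFun_mul {A B : Matrix n n ℂ} (hA : A.IsHermitian) (hB : B.IsHermitian)
    (f g : ℝ → ℝ) :
    (spectralFun hA f * spectralFun hB g).trace.re =
      ∑ i, ∑ j, f (hA.eigenvalues i) * g (hB.eigenvalues j) * overlap hA hB i j := by
  set W := star hA.eigenvectorUnitary.1 * hB.eigenvectorUnitary.1 with hW
  have h : (spectralFun hA f * spectralFun hB g).trace =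
      (Matrix.diagonal (fun i => (f (hA.eigenvalues i) : ℂ)) * (W *
        (Matrix.diagonal (fun i => (g (hB.eigenvalues i) : ℂ)) * star W))).trace := by
    rw [hW, star_mul, star_star]
    simp only [spectralFun, Matrix.mul_assoc]
    rw [Matrix.trace_mul_comm]
    simp only [Matrix.mul_assoc]
  rw [h, Matrix.trace, Complex.re_sum]
  refine Finset.sum_congr rfl fun i _ => ?_
  rw [Matrix.diag_apply, Matrix.diagonal_mul, Complex.re_ofReal_mul, Matrix.mul_apply,
    Complex.re_sum, Finset.mul_sum]
  refine Finset.sum_congr rfl fun j _ => ?_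
  rw [Matrix.diagonal_mul, Matrix.star_apply, overlap, ← hW]
  have : W i j * ((g (hB.eigenvalues j) : ℂ) * star (W i j)) =
      ((g (hB.eigenvalues j) * Complex.normSq (W i j) : ℝ) : ℂ) := by
    rw [Complex.ofReal_mul, ← Complex.mul_conj, Complex.star_def]
    ring
  rw [this, Complex.ofReal_re, mul_assoc]

theorem overlap_nonneg {A B : Matrix n n ℂ} (hA : A.IsHermitian) (hB : B.IsHermitian) (i j : n) :
    0 ≤ overlap hA hB i j :=
  Complex.normSq_nonneg _

/-- The squared overlaps of a fixed `aᵢ` with the basis `bⱼ` sum to one. -/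
theorem sum_overlap_left {A B : Matrix n n ℂ} (hA : A.IsHermitian) (hB : B.IsHermitian)
    (f : ℝ → ℝ) :
    ∑ i, ∑ j, f (hA.eigenvalues i) * overlap hA hB i j = ∑ i, f (hA.eigenvalues i) := by
  have h := re_trace_spectralFun_mul hA hB f (fun _ => 1)
  rw [spectralFun_const, one_smul, Matrix.mul_one, re_trace_spectralFun] at h
  simpa using h.symm

/-- The squared overlaps of a fixed `bⱼ` with the basis `aᵢ` sum to one. -/
theorem sum_overlap_right {A B : Matrix n n ℂ} (hA : A.IsHermitian) (hB : B.IsHermitian)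
    (g : ℝ → ℝ) :
    ∑ i, ∑ j, g (hB.eigenvalues j) * overlap hA hB i j = ∑ j, g (hB.eigenvalues j) := by
  have h := re_trace_spectralFun_mul hA hB (fun _ => 1) g
  rw [spectralFun_const, one_smul, Matrix.one_mul, re_trace_spectralFun] at h
  simpa using h.symm

/-- The Bregman divergence of `-log det` between `A + r` and `B + r`, in the eigenbases of `A`
and `B`. -/
theorem logDet_bregman_eq_sum {A B : Matrix n n ℂ} (hA : A.PosSemidef) (hB : B.PosSemidef) {r : ℝ}
    (hr : 0 < r) :
    Real.log (B + r • (1 : Matrix n n ℂ)).det.re - Real.log (A + r • (1 : Matrix n n ℂ)).det.re +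
        ((B + r • (1 : Matrix n n ℂ))⁻¹ * (A - B)).trace.re =
      ∑ i, ∑ j, overlap hA.isHermitian hB.isHermitian i j *
        logBregman (hA.isHermitian.eigenvalues i) (hB.isHermitian.eigenvalues j) r := by
  have hlog : ∀ {C : Matrix n n ℂ} (hC : C.PosSemidef),
      Real.log (C + r • (1 : Matrix n n ℂ)).det.re =
        ∑ i, Real.log (hC.isHermitian.eigenvalues i + r) := by
    intro C hC
    rw [add_smul_one_eq_spectralFun hC.isHermitian, det_spectralFun, Real.log_prod]
    intro i _
    have := hC.eigenvalues_nonneg i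
    linarith
  have htr : ((B + r • (1 : Matrix n n ℂ))⁻¹ * (A - B)).trace.re =
      ∑ i, ∑ j, hA.isHermitian.eigenvalues i * (hB.isHermitian.eigenvalues j + r)⁻¹ *
          overlap hA.isHermitian hB.isHermitian i j -
        ∑ j, (hB.isHermitian.eigenvalues j + r)⁻¹ * hB.isHermitian.eigenvalues j := by
    have h1 := re_trace_spectralFun_mul hA.isHermitian hB.isHermitian (fun x => x)
      (fun x => (x + r)⁻¹)
    have h2 := re_trace_spectralFun hB.isHermitian (fun x => (x + r)⁻¹ * x)
    rw [← spectralFun_mul, ← inv_add_smul_one_eq_spectralFun hB hr, spectralFun_id] at h2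
    rw [← inv_add_smul_one_eq_spectralFun hB hr, spectralFun_id] at h1
    rw [mul_sub, Matrix.trace_sub, Complex.sub_re, Matrix.trace_mul_comm _ A, h1, h2]
  rw [hlog hA, hlog hB, htr,
    ← sum_overlap_left hA.isHermitian hB.isHermitian (fun x => Real.log (x + r)),
    ← sum_overlap_right hA.isHermitian hB.isHermitian (fun x => Real.log (x + r)),
    ← sum_overlap_right hA.isHermitian hB.isHermitian (fun x => (x + r)⁻¹ * x)]
  simp only [← Finset.sum_sub_distrib, ← Finset.sum_add_distrib]
  refine Finset.sum_congr rfl fun i _ => Finset.sum_congr rfl fun j _ => ?_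
  rw [logBregman, div_eq_mul_inv]
  ring

/-! ### Supports -/

/-- Douglas' factorization: a matrix whose range lies in that of `B` is a right multiple of
`B`. -/
theorem exists_eq_mul_of_supp_le {A B : Matrix n n ℂ} (h : supp A ≤ supp B) :
    ∃ M : Matrix n n ℂ, A = B * M := by
  have hcol : ∀ j, ∃ v : n → ℂ, B.mulVec v = A.col j := by
    intro j
    have hj : A.col j ∈ supp A := ⟨Pi.single j 1, by simp⟩
    exact h hj
  choose v hv using hcol
  refine ⟨Matrix.of fun i j => v j i, ?_⟩
  ext i j
  have := congrFun (hv j) i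
  simpa [Matrix.mul_apply, Matrix.mulVec, dotProduct] using this.symm

omit [DecidableEq n] in
theorem supp_mul_le (B M : Matrix n n ℂ) : supp (B * M) ≤ supp B := by
  rw [supp, supp, Matrix.mulVecLin_mul]
  exact LinearMap.range_comp_le_range _ _

/-- If `supp A ≤ supp B`, then the kernel of `B` is orthogonal to the eigenvectors of `A` with
nonzero eigenvalue. -/
theorem overlap_eq_zero_of_supp_le {A B : Matrix n n ℂ} (hA : A.IsHermitian) (hB : B.IsHermitian)
    (h : supp A ≤ supp B) {i j : n} (hj : hB.eigenvalues j = 0) (hi : hA.eigenvalues i ≠ 0) :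
    overlap hA hB i j = 0 := by
  obtain ⟨M, hM⟩ := exists_eq_mul_of_supp_le h
  set U := hA.eigenvectorUnitary.1 with hU
  set V := hB.eigenvectorUnitary.1 with hV
  have hUU : star U * U = 1 := Unitary.coe_star_mul_self _
  have hVV : star V * V = 1 := Unitary.coe_star_mul_self _
  have eA : A * U = U * Matrix.diagonal (fun i => (hA.eigenvalues i : ℂ)) := by
    conv_lhs => rw [← spectralFun_id hA]
    rw [spectralFun, ← hU, Matrix.mul_assoc, hUU, Matrix.mul_one]
  have eB : star V * B = Matrix.diagonal (fun i => (hB.eigenvalues i : ℂ)) * star V := by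
    conv_lhs => rw [← spectralFun_id hB]
    rw [spectralFun, ← hV, Matrix.mul_assoc, ← Matrix.mul_assoc, hVV, Matrix.one_mul]
  have e : star V * U * Matrix.diagonal (fun i => (hA.eigenvalues i : ℂ)) =
      Matrix.diagonal (fun i => (hB.eigenvalues i : ℂ)) * (star V * M * U) := by
    rw [Matrix.mul_assoc, ← eA, ← Matrix.mul_assoc, hM, ← Matrix.mul_assoc, eB]
    simp only [Matrix.mul_assoc]
  have e' := congrFun (congrFun e j) i
  rw [Matrix.mul_diagonal, Matrix.diagonal_mul, hj, Complex.ofReal_zero, zero_mul,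
    mul_eq_zero, or_iff_left (Complex.ofReal_ne_zero.mpr hi)] at e'
  have e2 : (star U * V) i j = star ((star V * U) j i) := by
    rw [← Matrix.star_apply, star_mul, star_star]
  rw [overlap, ← hU, ← hV, e2, e']
  simp

/-- Domination by a multiple of `B` gives `ker B ≤ ker A`, hence the inclusion of the ranges. -/
theorem supp_le_of_le_smul {A B : Matrix n n ℂ} (hA : A.PosSemidef) (hB : B.IsHermitian) {K : ℝ}
    (h : A ≤ K • B) : supp A ≤ supp B := by
  have hker : ∀ v, B.mulVec v = 0 → A.mulVec v = 0 := by
    intro v hv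
    rw [← hA.dotProduct_mulVec_zero_iff]
    have h1 := (Matrix.le_iff.mp h).dotProduct_mulVec_nonneg v
    rw [Matrix.sub_mulVec, Matrix.smul_mulVec, hv, smul_zero, zero_sub, dotProduct_neg] at h1
    exact le_antisymm (neg_nonneg.mp h1) (hA.dotProduct_mulVec_nonneg v)
  -- `1 - g(B) B`, with `g` the inverse away from zero, projects onto the kernel of `B`.
  have hAB : A = A * (spectralFun hB (fun x => x⁻¹) * B) := by
    have hz : B * (1 - spectralFun hB (fun x => x⁻¹) * B) = 0 := by
      have h3 : B * (spectralFun hB (fun x => x⁻¹) * B) = B := by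
        have h1 := spectralFun_mul hB (fun x => x⁻¹) (fun x => x)
        have h2 := spectralFun_mul hB (fun x => x) (fun x => x⁻¹ * x)
        rw [spectralFun_id] at h1 h2
        rw [h1, h2, spectralFun_congr hB (g := fun x => x), spectralFun_id]
        intro i
        simp only [← mul_assoc, mul_inv_mul_cancel]
      rw [mul_sub, mul_one, h3, sub_self]
    have hz' : A * (1 - spectralFun hB (fun x => x⁻¹) * B) = 0 := by
      ext i j
      have h4 : B.mulVec ((1 - spectralFun hB (fun x => x⁻¹) * B).col j) = 0 := by
        ext i
        exact congrFun (congrFun hz i) j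
      exact congrFun (hker _ h4) i
    rw [mul_sub, mul_one] at hz'
    exact sub_eq_zero.mp hz'
  have hAB' : A = B * ((spectralFun hB (fun x => x⁻¹)).conjTranspose * A) := by
    have := congrArg Matrix.conjTranspose hAB
    rw [Matrix.conjTranspose_mul, Matrix.conjTranspose_mul, hA.isHermitian.eq, hB.eq,
      Matrix.mul_assoc] at this
    exact this
  rw [hAB']
  exact supp_mul_le _ _

/-! ### The Bogoliubov–Kubo–Mori form -/

/-- The Bogoliubov–Kubo–Mori form `∫₀^∞ tr ((P + r)⁻¹ Δ (P + r)⁻¹ Δ) dr`, with values in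
`[0, ∞]` so that `P` may be singular. -/
noncomputable def bkmForm (P Δ : Matrix n n ℂ) : ℝ≥0∞ :=
  ∫⁻ r in Ioi (0 : ℝ), ENNReal.ofReal (traceForm (P + r • (1 : Matrix n n ℂ))⁻¹ Δ)

/-- The segment from `σ` to `ρ`. -/
noncomputable def segmentPath (ρ σ : Matrix n n ℂ) (t : ℝ) : Matrix n n ℂ :=
  σ + t • (ρ - σ)

/-- The integral of the Bogoliubov–Kubo–Mori form along the segment from `σ` to `ρ`, with the
weight `1 - t` of the remainder in Taylor's formula of second order. -/
noncomputable def bkmIntegral (ρ σ : Matrix n n ℂ) : ℝ≥0∞ :=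
  ∫⁻ t in Ioo (0 : ℝ) 1, ENNReal.ofReal (1 - t) * bkmForm (segmentPath ρ σ t) (ρ - σ)

omit [Fintype n] [DecidableEq n] in
theorem segmentPath_eq (ρ σ : Matrix n n ℂ) (t : ℝ) :
    segmentPath ρ σ t = (1 - t) • σ + t • ρ := by
  rw [segmentPath, smul_sub, sub_smul, one_smul]
  abel

omit [Fintype n] [DecidableEq n] in
theorem posSemidef_segmentPath {ρ σ : Matrix n n ℂ} (hρ : ρ.PosSemidef) (hσ : σ.PosSemidef) {t : ℝ}
    (ht : t ∈ Ioo (0 : ℝ) 1) : (segmentPath ρ σ t).PosSemidef := by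
  rw [segmentPath_eq]
  exact (hσ.smul (sub_nonneg.mpr ht.2.le)).add (hρ.smul ht.1.le)

theorem measurable_traceForm_inv {α : Type*} [TopologicalSpace α] [MeasurableSpace α]
    [OpensMeasurableSpace α] {M : α → Matrix n n ℂ} (hM : Continuous M) (Δ : Matrix n n ℂ) :
    Measurable fun a => traceForm (M a)⁻¹ Δ := by
  have hentry : ∀ i j, Measurable fun a => (M a)⁻¹ i j := by
    intro i j
    simp only [Matrix.inv_def, Ring.inverse_eq_inv', Matrix.smul_apply, smul_eq_mul]
    refine Measurable.mul (Measurable.inv hM.matrix_det.measurable) ?_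
    exact (hM.matrix_adjugate.matrix_elem i j).measurable
  have hmul : ∀ {X Y : α → Matrix n n ℂ}, (∀ i j, Measurable fun a => X a i j) →
      (∀ i j, Measurable fun a => Y a i j) → ∀ i j, Measurable fun a => (X a * Y a) i j := by
    intro X Y hX hY i j
    simp only [Matrix.mul_apply]
    exact Finset.measurable_fun_sum _ fun k _ => (hX i k).mul (hY k j)
  have hΔ : ∀ i j, Measurable fun _ : α => Δ i j := fun i j => measurable_const
  exact Complex.measurable_re.comp (Finset.measurable_fun_sum _ fun i _ =>
    hmul (hmul (hmul hentry hΔ) hentry) hΔ i i)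

theorem measurable_traceForm_resolvent (P Δ : Matrix n n ℂ) :
    Measurable fun r : ℝ => ENNReal.ofReal (traceForm (P + r • (1 : Matrix n n ℂ))⁻¹ Δ) :=
  (measurable_traceForm_inv (by fun_prop) Δ).ennreal_ofReal

theorem measurable_bkmForm_segmentPath (ρ σ Δ : Matrix n n ℂ) :
    Measurable fun t => bkmForm (segmentPath ρ σ t) Δ := by
  have h : Measurable fun p : ℝ × ℝ => ENNReal.ofReal
      (traceForm (segmentPath ρ σ p.1 + p.2 • (1 : Matrix n n ℂ))⁻¹ Δ) :=
    (measurable_traceForm_inv (by unfold segmentPath; fun_prop) Δ).ennreal_ofReal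
  exact h.lintegral_prod_right'

theorem bkmForm_smul (P Δ : Matrix n n ℂ) (k : ℝ) :
    bkmForm P (k • Δ) = ENNReal.ofReal (k ^ 2) * bkmForm P Δ := by
  simp only [bkmForm, traceForm_smul_right, ENNReal.ofReal_mul (sq_nonneg k)]
  rw [lintegral_const_mul' _ _ ENNReal.ofReal_ne_top]

theorem bkmForm_add_smul_le {P A B : Matrix n n ℂ} (hP : P.PosSemidef) (hA : A.IsHermitian)
    (hB : B.IsHermitian) {ζ : ℝ} (hζ : 0 ≤ ζ) :
    bkmForm P (A + ζ • B) ≤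
      ENNReal.ofReal (1 + ζ) * bkmForm P A + ENNReal.ofReal (ζ + ζ ^ 2) * bkmForm P B := by
  unfold bkmForm
  rw [← lintegral_const_mul' _ _ ENNReal.ofReal_ne_top,
    ← lintegral_const_mul' _ _ ENNReal.ofReal_ne_top,
    ← lintegral_add_left ((measurable_traceForm_resolvent P A).const_mul _)]
  refine setLIntegral_mono' measurableSet_Ioi fun r hr => ?_
  have hX := (posDef_add_smul_one hP hr).inv.posSemidef
  rw [← ENNReal.ofReal_mul (by positivity), ← ENNReal.ofReal_mul (by positivity),
    ← ENNReal.ofReal_add (mul_nonneg (by positivity) (traceForm_nonneg hX hA))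
      (mul_nonneg (by positivity) (traceForm_nonneg hX hB))]
  exact ENNReal.ofReal_le_ofReal (traceForm_add_smul_le hX hA hB hζ)

theorem lintegral_Ioi_mul_comp_mul_left (f : ℝ → ℝ≥0∞) {K : ℝ} (hK : 0 < K) :
    ∫⁻ r in Ioi (0 : ℝ), ENNReal.ofReal K * f (K * r) = ∫⁻ r in Ioi (0 : ℝ), f r := by
  have himg : (fun r : ℝ => K * r) '' Ioi 0 = Ioi 0 := by
    rw [image_mul_left_Ioi hK, mul_zero]
  have h := lintegral_image_eq_lintegral_abs_deriv_mul (s := Ioi 0) (f := fun r : ℝ => K * r)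
    (f' := fun _ => K) measurableSet_Ioi
    (fun r _ => by simpa using ((hasDerivAt_id r).const_mul K).hasDerivWithinAt)
    (fun a _ b _ hab => mul_left_cancel₀ hK.ne' hab) f
  rw [himg, abs_of_pos hK] at h
  exact h.symm

/-- The form is of degree `-1` and antitone in its base point. The factor is `K` and not `K ^ 2`
because the resolvent parameter is rescaled along with the base point. -/
theorem bkmForm_le_of_le_smul {P P' Δ : Matrix n n ℂ} (hP : P.PosSemidef) (hP' : P'.PosSemidef)
    (hΔ : Δ.IsHermitian) {K : ℝ} (hK : 0 < K) (hle : P' ≤ K • P) :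
    bkmForm P Δ ≤ ENNReal.ofReal K * bkmForm P' Δ := by
  unfold bkmForm
  rw [← lintegral_Ioi_mul_comp_mul_left
    (fun r => ENNReal.ofReal (traceForm (P' + r • (1 : Matrix n n ℂ))⁻¹ Δ)) hK,
    ← lintegral_const_mul' _ _ ENNReal.ofReal_ne_top]
  refine setLIntegral_mono' measurableSet_Ioi fun r hr => ?_
  rw [← ENNReal.ofReal_mul hK.le, ← ENNReal.ofReal_mul hK.le, ← mul_assoc, ← pow_two]
  exact ENNReal.ofReal_le_ofReal (traceForm_resolvent_le hP hP' hΔ hK hr hle)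

/-! ### Integral formula for the relative entropy -/

/-- The relative entropy is the Taylor remainder of second order of `X ↦ tr (X ln X)`, whose
Hessian is the Bogoliubov–Kubo–Mori form. -/
theorem exists_relEntropy_eq_bkmIntegral {ρ σ : Matrix n n ℂ} (hρ : IsDensity ρ)
    (hσ : IsDensity σ) (hsupp : supp ρ ≤ supp σ) :
    ∃ d : ℝ, 0 ≤ d ∧ relEntropy ρ σ = d ∧ ENNReal.ofReal d = bkmIntegral ρ σ := by
  have hρ' := hρ.posSemidef
  have hσ' := hσ.posSemidef
  set p := hρ'.isHermitian.eigenvalues with hp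
  set q := hσ'.isHermitian.eigenvalues with hq
  set w := overlap hρ'.isHermitian hσ'.isHermitian with hw
  have hp0 : ∀ i, 0 ≤ p i := hρ'.eigenvalues_nonneg
  have hq0 : ∀ j, 0 ≤ q j := hσ'.eigenvalues_nonneg
  have hw0 : ∀ i j, 0 ≤ w i j := overlap_nonneg _ _
  have hpq : ∀ i j, w i j ≠ 0 → q j = 0 → p i = 0 := by
    intro i j hwij hqj
    by_contra hpi
    exact hwij (overlap_eq_zero_of_supp_le _ _ hsupp hqj hpi)
  have hint : ∀ i j, IntegrableOn (fun r => w i j * logBregman (p i) (q j) r) (Ioi 0) := by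
    intro i j
    by_cases hwij : w i j = 0
    · simp [hwij]
    · exact (integrableOn_logBregman (hp0 i) (hq0 j) (hpq i j hwij)).const_mul _
  have hval : ∀ i j, ∫ r in Ioi (0 : ℝ), w i j * logBregman (p i) (q j) r =
      w i j * (p i * Real.log (p i) - p i * Real.log (q j) - p i + q j) := by
    intro i j
    by_cases hwij : w i j = 0
    · simp [hwij]
    · rw [integral_const_mul, integral_logBregman (hp0 i) (hq0 j) (hpq i j hwij)]
  -- The terms `- p i + q j` cancel in the sum because the traces agree.
  have hsum : (ρ * (matLog ρ - matLog σ)).trace.re =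
      ∑ i, ∑ j, w i j * (p i * Real.log (p i) - p i * Real.log (q j) - p i + q j) := by
    have h1 := spectralFun_mul hρ'.isHermitian (fun x => x) Real.log
    have h2 := re_trace_spectralFun_mul hρ'.isHermitian hσ'.isHermitian (fun x => x) Real.log
    have h3 := re_trace_spectralFun hρ'.isHermitian (fun x => x)
    have h4 := re_trace_spectralFun hσ'.isHermitian (fun x => x)
    rw [spectralFun_id, ← matLog_eq_spectralFun] at h1
    rw [spectralFun_id, ← matLog_eq_spectralFun] at h2
    rw [spectralFun_id, hρ.trace_eq_one,
      ← sum_overlap_left hρ'.isHermitian hσ'.isHermitian (fun x => x)] at h3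
    rw [spectralFun_id, hσ.trace_eq_one,
      ← sum_overlap_right hρ'.isHermitian hσ'.isHermitian (fun x => x)] at h4
    have h5 := h3.symm.trans h4
    rw [mul_sub, Matrix.trace_sub, Complex.sub_re, h1, h2, re_trace_spectralFun,
      ← sum_overlap_left hρ'.isHermitian hσ'.isHermitian (fun x => x * Real.log x)]
    rw [← sub_eq_zero, ← Finset.sum_sub_distrib] at h5
    rw [← sub_eq_zero]
    refine Eq.trans ?_ h5
    simp only [← Finset.sum_sub_distrib]
    refine Finset.sum_congr rfl fun i _ => Finset.sum_congr rfl fun j _ => ?_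
    simp only [hp, hq, hw]
    ring
  have hnn : ∀ r ∈ Ioi (0 : ℝ), 0 ≤ ∑ i, ∑ j, w i j * logBregman (p i) (q j) r := fun r hr =>
    Finset.sum_nonneg fun i _ => Finset.sum_nonneg fun j _ =>
      mul_nonneg (hw0 i j) (logBregman_nonneg (hp0 i) (hq0 j) hr)
  have hd : (ρ * (matLog ρ - matLog σ)).trace.re =
      ∫ r in Ioi (0 : ℝ), ∑ i, ∑ j, w i j * logBregman (p i) (q j) r := by
    rw [hsum, integral_finsetSum _ fun i _ => integrable_finsetSum _ fun j _ => hint i j]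
    refine Finset.sum_congr rfl fun i _ => ?_
    rw [integral_finsetSum _ fun j _ => hint i j]
    exact Finset.sum_congr rfl fun j _ => (hval i j).symm
  refine ⟨_, ?_, if_pos hsupp, ?_⟩
  · rw [hd]
    exact setIntegral_nonneg measurableSet_Ioi hnn
  have hΔ : (ρ - σ).IsHermitian := hρ'.isHermitian.sub hσ'.isHermitian
  have hinner : ∀ r ∈ Ioi (0 : ℝ),
      ENNReal.ofReal (∑ i, ∑ j, w i j * logBregman (p i) (q j) r) =
        ∫⁻ t in Ioo (0 : ℝ) 1, ENNReal.ofReal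
          ((1 - t) * traceForm (segmentPath ρ σ t + r • (1 : Matrix n n ℂ))⁻¹ (ρ - σ)) := by
    intro r hr
    have e : σ + r • (1 : Matrix n n ℂ) + (ρ - σ) = ρ + r • (1 : Matrix n n ℂ) := by abel
    have h := lintegral_traceForm_inv (posDef_add_smul_one hσ' hr) hΔ
      (by rw [e]; exact posDef_add_smul_one hρ' hr)
    rw [e, logDet_bregman_eq_sum hρ' hσ' hr] at h
    rw [← h]
    simp only [segmentPath, add_right_comm]
  have hmeas : Measurable fun x : ℝ × ℝ => ENNReal.ofReal
      ((1 - x.2) * traceForm (segmentPath ρ σ x.2 + x.1 • (1 : Matrix n n ℂ))⁻¹ (ρ - σ)) :=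
    (Measurable.mul (by fun_prop)
      (measurable_traceForm_inv (by unfold segmentPath; fun_prop) _)).ennreal_ofReal
  rw [hd, ofReal_integral_eq_lintegral_ofReal
    (integrable_finsetSum _ fun i _ => integrable_finsetSum _ fun j _ => hint i j)
    ((ae_restrict_iff' measurableSet_Ioi).mpr (Filter.Eventually.of_forall hnn)),
    setLIntegral_congr_fun measurableSet_Ioi hinner,
    lintegral_lintegral_swap hmeas.aemeasurable, bkmIntegral]
  refine setLIntegral_congr_fun measurableSet_Ioo fun t ht => ?_
  have ht1 : 0 ≤ 1 - t := sub_nonneg.mpr ht.2.le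
  simp only [bkmForm, ENNReal.ofReal_mul ht1]
  rw [lintegral_const_mul' _ _ ENNReal.ofReal_ne_top]

/-! ### Comparison of the integrals -/

omit [Fintype n] [DecidableEq n] in
theorem segmentPath_le_smul {ρ σ ω : Matrix n n ℂ} (hρ : ρ.PosSemidef) {K : ℝ} (hK : 1 ≤ K)
    (h : ω ≤ K • σ) {t : ℝ} (ht : t ∈ Ioo (0 : ℝ) 1) :
    segmentPath ρ ω t ≤ K • segmentPath ρ σ t := by
  have h1 := (Matrix.PosSemidef.smul (Matrix.le_iff.mp h) (sub_nonneg.mpr ht.2.le)).add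
    (hρ.smul (mul_nonneg ht.1.le (sub_nonneg.mpr hK)))
  rw [Matrix.le_iff]
  convert h1 using 1
  rw [segmentPath_eq, segmentPath_eq]
  module

/-- The base point `σ` of the segment is replaced by `ω ≤ K σ`, at the cost of a factor `K`. -/
theorem lintegral_bkmForm_le {ρ σ ω : Matrix n n ℂ} (hρ : ρ.PosSemidef) (hσ : σ.PosSemidef)
    (hω : ω.PosSemidef) {K : ℝ} (hK : 1 ≤ K) (h : ω ≤ K • σ) :
    ∫⁻ t in Ioo (0 : ℝ) 1, ENNReal.ofReal (1 - t) * bkmForm (segmentPath ρ σ t) (ρ - ω) ≤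
      ENNReal.ofReal K * bkmIntegral ρ ω := by
  rw [bkmIntegral, ← lintegral_const_mul' _ _ ENNReal.ofReal_ne_top]
  refine setLIntegral_mono' measurableSet_Ioo fun t ht => ?_
  rw [mul_left_comm]
  gcongr
  exact bkmForm_le_of_le_smul (posSemidef_segmentPath hρ hσ ht) (posSemidef_segmentPath hρ hω ht)
    (hρ.isHermitian.sub hω.isHermitian) (by linarith) (segmentPath_le_smul hρ hK h ht)

theorem lintegral_bkmForm_add_smul_le {ρ σ A B : Matrix n n ℂ} (hρ : ρ.PosSemidef)
    (hσ : σ.PosSemidef) (hA : A.IsHermitian) (hB : B.IsHermitian) {ζ : ℝ} (hζ : 0 ≤ ζ) :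
    ∫⁻ t in Ioo (0 : ℝ) 1, ENNReal.ofReal (1 - t) * bkmForm (segmentPath ρ σ t) (A + ζ • B) ≤
      ENNReal.ofReal (1 + ζ) *
          (∫⁻ t in Ioo (0 : ℝ) 1, ENNReal.ofReal (1 - t) * bkmForm (segmentPath ρ σ t) A) +
        ENNReal.ofReal (ζ + ζ ^ 2) *
          ∫⁻ t in Ioo (0 : ℝ) 1, ENNReal.ofReal (1 - t) * bkmForm (segmentPath ρ σ t) B := by
  have hm : Measurable fun t => ENNReal.ofReal (1 - t) * bkmForm (segmentPath ρ σ t) A :=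
    Measurable.mul (by fun_prop) (measurable_bkmForm_segmentPath ρ σ A)
  rw [← lintegral_const_mul' _ _ ENNReal.ofReal_ne_top,
    ← lintegral_const_mul' _ _ ENNReal.ofReal_ne_top, ← lintegral_add_left (hm.const_mul _)]
  refine setLIntegral_mono' measurableSet_Ioo fun t ht => ?_
  rw [mul_left_comm, mul_left_comm (ENNReal.ofReal (ζ + ζ ^ 2)), ← mul_add]
  gcongr
  exact bkmForm_add_smul_le (posSemidef_segmentPath hρ hσ ht) hA hB hζ

/-- The first comparison, from `(1 - ζ) (ρ - σ) = (ρ - ω) + ζ (η - ρ)`. -/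
theorem bkmIntegral_le_add_bkmIntegral {ρ σ ω η : Matrix n n ℂ} (hρ : ρ.PosSemidef)
    (hσ : σ.PosSemidef) (hω : ω.PosSemidef) (hη : η.PosSemidef) {ζ c K : ℝ} (hζ : 0 ≤ ζ)
    (hc : 1 ≤ c) (hK : 1 ≤ K) (hmix : ζ • η + (1 - ζ) • σ = ω) (hωK : ω ≤ K • σ)
    (hηc : η ≤ c • σ) :
    ENNReal.ofReal ((1 - ζ) ^ 2) * bkmIntegral ρ σ ≤
      ENNReal.ofReal ((1 + ζ) * K) * bkmIntegral ρ ω +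
        ENNReal.ofReal ((ζ + ζ ^ 2) * c) * bkmIntegral ρ η := by
  have e : (1 - ζ) • (ρ - σ) = (ρ - ω) + (-ζ) • (ρ - η) := by
    rw [← hmix]
    module
  have e' : (1 - ζ) • (ρ - σ) = (ρ - ω) + ζ • ((-1 : ℝ) • (ρ - η)) := by
    rw [e]
    module
  have hρη : (ρ - η).IsHermitian := hρ.isHermitian.sub hη.isHermitian
  have hneg : ((-1 : ℝ) • (ρ - η)).IsHermitian := by
    rw [neg_one_smul]
    exact hρη.neg
  have h := lintegral_bkmForm_add_smul_le hρ hσ (hρ.isHermitian.sub hω.isHermitian) hneg hζ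
  rw [← e'] at h
  simp only [bkmForm_smul, neg_one_sq, ENNReal.ofReal_one, one_mul,
    mul_left_comm _ (ENNReal.ofReal ((1 - ζ) ^ 2))] at h
  rw [lintegral_const_mul' _ _ ENNReal.ofReal_ne_top] at h
  refine h.trans ?_
  rw [ENNReal.ofReal_mul (by positivity), ENNReal.ofReal_mul (by positivity), mul_assoc, mul_assoc]
  gcongr
  · exact lintegral_bkmForm_le hρ hσ hω hK hωK
  · exact lintegral_bkmForm_le hρ hσ hη hc hηc

/-- The second comparison, from `ρ - σ = (ρ - ω) + ζ (η - σ)`. The segment from `σ` to `ρ` is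
bounded below by `(1 - t) σ`, and `1 / (1 - t)` cancels the weight of the remainder. -/
theorem bkmIntegral_le_add_bkmForm {ρ σ ω η : Matrix n n ℂ} (hρ : ρ.PosSemidef)
    (hσ : σ.PosSemidef) (hω : ω.PosSemidef) (hη : η.PosSemidef) {ζ K : ℝ} (hζ : 0 ≤ ζ)
    (hK : 1 ≤ K) (hmix : ζ • η + (1 - ζ) • σ = ω) (hωK : ω ≤ K • σ) :
    bkmIntegral ρ σ ≤ ENNReal.ofReal ((1 + ζ) * K) * bkmIntegral ρ ω +
        ENNReal.ofReal (ζ + ζ ^ 2) * bkmForm σ (η - σ) := by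
  have e : ρ - σ = (ρ - ω) + ζ • (η - σ) := by
    rw [← hmix]
    module
  have hησ : (η - σ).IsHermitian := hη.isHermitian.sub hσ.isHermitian
  have h := lintegral_bkmForm_add_smul_le hρ hσ (hρ.isHermitian.sub hω.isHermitian) hησ hζ
  rw [← e] at h
  refine h.trans ?_
  rw [ENNReal.ofReal_mul (by positivity), mul_assoc]
  gcongr
  · exact lintegral_bkmForm_le hρ hσ hω hK hωK
  · calc _ ≤ ∫⁻ _ in Ioo (0 : ℝ) 1, bkmForm σ (η - σ) := by
          refine setLIntegral_mono' measurableSet_Ioo fun t ht => ?_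
          have ht1 : 0 < 1 - t := sub_pos.mpr ht.2
          have hle : σ ≤ (1 - t)⁻¹ • segmentPath ρ σ t := by
            rw [segmentPath_eq, smul_add, smul_smul, smul_smul, inv_mul_cancel₀ ht1.ne', one_smul,
              Matrix.le_iff, add_sub_cancel_left]
            exact hρ.smul (mul_nonneg (inv_nonneg.mpr ht1.le) ht.1.le)
          have h1 := bkmForm_le_of_le_smul (posSemidef_segmentPath hρ hσ ht) hσ hησ
            (inv_pos.mpr ht1) hle
          calc _ ≤ ENNReal.ofReal (1 - t) * (ENNReal.ofReal (1 - t)⁻¹ * bkmForm σ (η - σ)) := by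
                gcongr
            _ = _ := by
                rw [← mul_assoc, ← ENNReal.ofReal_mul ht1.le, mul_inv_cancel₀ ht1.ne',
                  ENNReal.ofReal_one, one_mul]
      _ = _ := by simp

/-- If `η ≤ c σ`, the segment from `σ` to `η` stays below `(1 + t (c - 1)) σ`, so the relative
entropy controls the form at `σ`. -/
theorem bkmForm_le_compFactor_mul {σ η : Matrix n n ℂ} (hσ : σ.PosSemidef) (hη : η.PosSemidef)
    {c : ℝ} (hc : 1 ≤ c) (hηc : η ≤ c • σ) :
    bkmForm σ (η - σ) ≤ ENNReal.ofReal (compFactor c) * bkmIntegral η σ := by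
  have hF := compFactor_pos hc
  have h : ENNReal.ofReal (compFactor c)⁻¹ * bkmForm σ (η - σ) ≤ bkmIntegral η σ := by
    -- `lintegral_compFactor` writes the constant as an integral over `t`, which is compared
    -- pointwise with `bkmIntegral`.
    rw [← lintegral_compFactor hc, ← lintegral_mul_const _ (by fun_prop), bkmIntegral]
    refine setLIntegral_mono' measurableSet_Ioo fun t ht => ?_
    have hpos : 0 < 1 + t * (c - 1) := one_add_mul_pos (by linarith) (Ioo_subset_Icc_self ht)
    have hle : segmentPath η σ t ≤ (1 + t * (c - 1)) • σ := by
      have h1 := Matrix.PosSemidef.smul (Matrix.le_iff.mp hηc) ht.1.le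
      rw [Matrix.le_iff]
      convert h1 using 1
      rw [segmentPath]
      module
    have h1 := bkmForm_le_of_le_smul hσ (posSemidef_segmentPath hη hσ ht)
      (hη.isHermitian.sub hσ.isHermitian) hpos hle
    have ht1 : 0 ≤ 1 - t := sub_nonneg.mpr ht.2.le
    calc _ ≤ ENNReal.ofReal ((1 - t) / (1 + t * (c - 1))) *
          (ENNReal.ofReal (1 + t * (c - 1)) * bkmForm (segmentPath η σ t) (η - σ)) := by gcongr
      _ = _ := by
        rw [← mul_assoc, ← ENNReal.ofReal_mul (by positivity), div_mul_cancel₀ _ hpos.ne']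
  calc bkmForm σ (η - σ) =
        ENNReal.ofReal (compFactor c) * (ENNReal.ofReal (compFactor c)⁻¹ * bkmForm σ (η - σ)) := by
        rw [← mul_assoc, ← ENNReal.ofReal_mul hF.le, mul_inv_cancel₀ hF.ne', ENNReal.ofReal_one,
          one_mul]
    _ ≤ _ := by gcongr

/-! ### Extended real values -/

theorem mul_relEntropy_ne_bot {a : ℝ} (ha : 0 < a) (ρ σ : Matrix n n ℂ) :
    (a : EReal) * relEntropy ρ σ ≠ ⊥ := by
  unfold relEntropy
  split_ifs
  · rw [← EReal.coe_mul]
    exact EReal.coe_ne_bot _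
  · rw [EReal.coe_mul_top_of_pos ha]
    exact top_ne_bot

theorem mul_relEntropy_eq_top {a : ℝ} (ha : 0 < a) {ρ σ : Matrix n n ℂ}
    (h : ¬ supp ρ ≤ supp σ) : (a : EReal) * relEntropy ρ σ = ⊤ := by
  rw [relEntropy, if_neg h, EReal.coe_mul_top_of_pos ha]

theorem mul_add_mul_le_of_ofReal {a b c x y z : ℝ} (hb : 0 ≤ b) (hc : 0 ≤ c)
    (hy : 0 ≤ y) (hz : 0 ≤ z) (ha : 0 ≤ a)
    (h : ENNReal.ofReal a * ENNReal.ofReal x ≤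
      ENNReal.ofReal b * ENNReal.ofReal y + ENNReal.ofReal c * ENNReal.ofReal z) :
    a * x ≤ b * y + c * z := by
  rw [← ENNReal.ofReal_mul ha, ← ENNReal.ofReal_mul hb, ← ENNReal.ofReal_mul hc,
    ← ENNReal.ofReal_add (by positivity) (by positivity)] at h
  exact (ENNReal.ofReal_le_ofReal_iff (by positivity)).mp h

end QuantumInfo

open QuantumInfo in
theorem mainTheorem2 {n : Type*} [Fintype n] [DecidableEq n]
    (ρ σ ω η : Matrix n n ℂ)
    (hρ : QuantumInfo.IsDensity ρ) (hσ : QuantumInfo.IsDensity σ) (hω : QuantumInfo.IsDensity ω)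
    (ζ c : ℝ) (hζ0 : 0 < ζ) (hζ1 : ζ < 1) (hc : 1 ≤ c)
    (hlow : (1 - ζ) • σ ≤ ω) (hupp : ω ≤ (1 + ζ * (c - 1)) • σ)
    (hη : η = ζ⁻¹ • (ω - (1 - ζ) • σ)) :
    ζ • η + (1 - ζ) • σ = ω ∧
    QuantumInfo.IsDensity η ∧
    (((1 - ζ) ^ 2 : ℝ) : EReal) * QuantumInfo.relEntropy ρ σ ≤
      ((1 + ζ * (c + 1) + 2 * ζ ^ 2 * (c - 1) : ℝ) : EReal) * QuantumInfo.relEntropy ρ ω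
        + ((ζ * (2 + ζ) * c : ℝ) : EReal) * QuantumInfo.relEntropy ρ η ∧
    (((1 - ζ) ^ 2 : ℝ) : EReal) * QuantumInfo.relEntropy ρ σ ≤
      ((1 + ζ * (c + 1) + 2 * ζ ^ 2 * (c - 1) : ℝ) : EReal) * QuantumInfo.relEntropy ρ ω
        + ((3 * ζ * (2 + ζ) * (1 + QuantumInfo.compFactor c) : ℝ) : EReal)
          * QuantumInfo.relEntropy η σ := by
  have hmix : ζ • η + (1 - ζ) • σ = ω := by
    rw [hη, smul_smul, mul_inv_cancel₀ hζ0.ne', one_smul, sub_add_cancel]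
  have hηd : IsDensity η := by
    refine ⟨?_, ?_⟩
    · rw [hη]
      exact Matrix.PosSemidef.smul (Matrix.le_iff.mp hlow) (inv_nonneg.mpr hζ0.le)
    · have hζ' : (ζ : ℂ) ≠ 0 := Complex.ofReal_ne_zero.mpr hζ0.ne'
      rw [hη, Matrix.trace_smul, Matrix.trace_sub, Matrix.trace_smul, hω.trace_eq_one,
        hσ.trace_eq_one, Complex.real_smul, Complex.real_smul]
      push_cast
      field_simp
      ring
  have hηc : η ≤ c • σ := by
    have h := Matrix.PosSemidef.smul (Matrix.le_iff.mp hupp) (inv_nonneg.mpr hζ0.le)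
    rw [Matrix.le_iff]
    convert h using 1
    rw [← hmix, ← sub_eq_zero]
    have : c • σ = ζ⁻¹ • (ζ * c) • σ := by rw [smul_smul, inv_mul_cancel_left₀ hζ0.ne']
    have h' : η = ζ⁻¹ • ζ • η := by rw [smul_smul, inv_mul_cancel₀ hζ0.ne', one_smul]
    rw [this]
    conv_lhs => enter [1, 2]; rw [h']
    module
  have hc0 : 0 < c := by linarith
  have hK : 1 ≤ 1 + ζ * (c - 1) := by
    have := mul_nonneg hζ0.le (sub_nonneg.mpr hc)
    linarith
  have hF := compFactor_pos hc
  have hcoef1 : 0 < 1 + ζ * (c + 1) + 2 * ζ ^ 2 * (c - 1) := by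
    have := sub_nonneg.mpr hc
    positivity
  have hcoef2 : 0 < ζ * (2 + ζ) * c := by positivity
  have hcoef3 : 0 < 3 * ζ * (2 + ζ) * (1 + compFactor c) := by positivity
  have hcoefK : (1 + ζ) * (1 + ζ * (c - 1)) ≤ 1 + ζ * (c + 1) + 2 * ζ ^ 2 * (c - 1) := by
    have := mul_nonneg (sq_nonneg ζ) (sub_nonneg.mpr hc)
    nlinarith
  have hωσ : supp ω ≤ supp σ :=
    supp_le_of_le_smul hω.posSemidef hσ.posSemidef.isHermitian hupp
  have hσω : supp σ ≤ supp ω := by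
    refine supp_le_of_le_smul (K := (1 - ζ)⁻¹) hσ.posSemidef hω.posSemidef.isHermitian ?_
    have h := Matrix.PosSemidef.smul (Matrix.le_iff.mp hlow)
      (inv_nonneg.mpr (sub_pos.mpr hζ1).le)
    rwa [smul_sub, smul_smul, inv_mul_cancel₀ (sub_pos.mpr hζ1).ne', one_smul] at h
  have hησ : supp η ≤ supp σ :=
    supp_le_of_le_smul hηd.posSemidef hσ.posSemidef.isHermitian hηc
  refine ⟨hmix, hηd, ?_, ?_⟩
  -- `σ` and `ω` have the same support, so a left-hand side `⊤` forces `D(ρ‖ω) = ⊤`.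
  · by_cases hρσ : supp ρ ≤ supp σ
    · by_cases hρη : supp ρ ≤ supp η
      · obtain ⟨x, hx, hxD, hxI⟩ := exists_relEntropy_eq_bkmIntegral hρ hσ hρσ
        obtain ⟨y, hy, hyD, hyI⟩ := exists_relEntropy_eq_bkmIntegral hρ hω (hρσ.trans hσω)
        obtain ⟨z, hz, hzD, hzI⟩ := exists_relEntropy_eq_bkmIntegral hρ hηd hρη
        have h := bkmIntegral_le_add_bkmIntegral hρ.posSemidef hσ.posSemidef hω.posSemidef
          hηd.posSemidef hζ0.le hc hK hmix hupp hηc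
        rw [← hxI, ← hyI, ← hzI] at h
        rw [hxD, hyD, hzD]
        refine mod_cast mul_add_mul_le_of_ofReal hcoef1.le hcoef2.le hy hz (sq_nonneg _)
          (h.trans ?_)
        gcongr
        nlinarith
      · rw [mul_relEntropy_eq_top hcoef2 hρη,
          EReal.add_top_of_ne_bot (mul_relEntropy_ne_bot hcoef1 ρ ω)]
        exact le_top
    · rw [mul_relEntropy_eq_top hcoef1 fun h => hρσ (h.trans hωσ),
        EReal.top_add_of_ne_bot (mul_relEntropy_ne_bot hcoef2 ρ η)]
      exact le_top
  · by_cases hρσ : supp ρ ≤ supp σ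
    · obtain ⟨x, hx, hxD, hxI⟩ := exists_relEntropy_eq_bkmIntegral hρ hσ hρσ
      obtain ⟨y, hy, hyD, hyI⟩ := exists_relEntropy_eq_bkmIntegral hρ hω (hρσ.trans hσω)
      obtain ⟨z, hz, hzD, hzI⟩ := exists_relEntropy_eq_bkmIntegral hηd hσ hησ
      have h := bkmIntegral_le_add_bkmForm hρ.posSemidef hσ.posSemidef hω.posSemidef
        hηd.posSemidef hζ0.le hK hmix hupp
      have h' := bkmForm_le_compFactor_mul hσ.posSemidef hηd.posSemidef hc hηc
      rw [← hzI] at h'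
      rw [← hxI, ← hyI] at h
      rw [hxD, hyD, hzD]
      refine mod_cast mul_add_mul_le_of_ofReal hcoef1.le hcoef3.le hy hz (sq_nonneg _) ?_
      have hone : ENNReal.ofReal ((1 - ζ) ^ 2) ≤ 1 := by
        rw [ENNReal.ofReal_le_one]
        nlinarith
      refine (mul_le_of_le_one_left' hone).trans (h.trans ?_)
      gcongr ?_ + ?_
      · gcongr
      · calc _ ≤ ENNReal.ofReal (ζ + ζ ^ 2) *
              (ENNReal.ofReal (compFactor c) * ENNReal.ofReal z) := by gcongr
          _ = ENNReal.ofReal ((ζ + ζ ^ 2) * compFactor c) * ENNReal.ofReal z := by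
              rw [← mul_assoc, ← ENNReal.ofReal_mul (by positivity)]
          _ ≤ _ := by
              gcongr ENNReal.ofReal ?_ * _
              nlinarith [mul_pos hζ0 hF, mul_pos (pow_pos hζ0 2) hF, pow_pos hζ0 2]
    · rw [mul_relEntropy_eq_top hcoef1 fun h => hρσ (h.trans hωσ),
        EReal.top_add_of_ne_bot (mul_relEntropy_ne_bot hcoef3 η σ)]
      exact le_top
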